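/- Let $X$ be a complex Banach space (in particular, an infinite-dimensional one) and let $T\in L(X)$ be a bounded linear operator. For a bounded operator $S$ on a Banach space, with kernel $\mathcal N(S)$ and range $\mathcal R(S)$, say that $S$ is - *upper semi-Fredholm* if $\mathcal R(S)$ is closed and $\dim\mathcal N(S)<\infty$; *lower semi-Fredholm* if $\operatorname{codim}\mathcal R(S)<\infty$; *semi-Fredholm* if it is upper or lower semi-Fredholm; - *semi-regular* if $\mathcal R(S)$ is closed and $\mathcal N(S)\subset\bigcap_{n\in\mathbb N}\mathcal R(S^n)$; - *quasi-nilpotent* if its spectrum satisfies $\sigma(S)\subset\{0\}$ (so the operator on the zero space is quasi-nilpotent). Write $(M,N)\in \mathrm{Red}(T)$ if $M$ and $N$ are closed $T$-invariant subspaces of $X$ with $X=M\oplus N$ (possibly $M=\{0\}$ or $N=\{0\}$), and let $T_M:M\to M$ and $T_N:N\to N$ denote the restrictions of $T$. The operator $T$ is *upper* (resp. *lower*) *pseudo semi-B-Fredholm* if there is $(M,N)\in\mathrm{Red}(T)$ such that $T_M$ is upper (resp. lower) semi-Fredholm and $T_N$ is quasi-nilpotent; it is *pseudo semi-B-Fredholm*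 if it is upper or lower pseudo semi-B-Fredholm. It is *pseudo-Fredholm* if there is $(M,N)\in\mathrm{Red}(T)$ such that $T_M$ is semi-regular and $T_N$ is quasi-nilpotent. Then $T$ is pseudo semi-B-Fredholm if and only if there is $(M,N)\in\mathrm{Red}(T)$ such that $T_M$ is both semi-Fredholm and semi-regular and $T_N$ is quasi-nilpotent (that is, $T=T_1\oplus T_2$ with $T_1$ semi-Fredholm and semi-regular and $T_2$ quasi-nilpotent). In particular, every pseudo semi-B-Fredholm operator is pseudo-Fredholm. -/

import Mathlib

namespace PseudoFredholm

section Operators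

variable {Y : Type*} [NormedAddCommGroup Y] [NormedSpace ℂ Y]

/-- `T` is upper semi-Fredholm: closed range and finite-dimensional kernel. -/
def IsUpperSemiFredholm (T : Y →L[ℂ] Y) : Prop :=
  IsClosed (T.range : Set Y) ∧ FiniteDimensional ℂ T.ker

/-- `T` is lower semi-Fredholm: the range has finite codimension. -/
def IsLowerSemiFredholm (T : Y →L[ℂ] Y) : Prop :=
  FiniteDimensional ℂ (Y ⧸ T.range)

/-- `T` is semi-Fredholm: upper or lower semi-Fredholm. -/
def IsSemiFredholm (T : Y →L[ℂ] Y) : Prop :=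
  IsUpperSemiFredholm T ∨ IsLowerSemiFredholm T

/-- `T` is semi-regular: closed range, and the kernel lies in the range of every power. -/
def IsSemiRegular (T : Y →L[ℂ] Y) : Prop :=
  IsClosed (T.range : Set Y) ∧ T.ker ≤ ⨅ n : ℕ, (T ^ n).range

/-- `T` is quasi-nilpotent: the spectrum has no point other than `0`. (On the zero space, where the
spectrum is empty, the only operator is quasi-nilpotent.) -/
def IsQuasiNilpotent (T : Y →L[ℂ] Y) : Prop :=
  spectrum ℂ T ⊆ {0}

/-- `(M, N) ∈ Red(T)`: `M` and `N` are closed `T`-invariant subspaces whose direct sum is the whole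
space. -/
structure Reduces (T : Y →L[ℂ] Y) (M N : Submodule ℂ Y) : Prop where
  isClosed_left : IsClosed (M : Set Y)
  isClosed_right : IsClosed (N : Set Y)
  mapsTo_left : Set.MapsTo T M M
  mapsTo_right : Set.MapsTo T N N
  isCompl : IsCompl M N

/-- `T` is upper pseudo semi-B-Fredholm. -/
def IsUpperPseudoSemiBFredholm (T : Y →L[ℂ] Y) : Prop :=
  ∃ (M N : Submodule ℂ Y) (h : Reduces T M N),
    IsUpperSemiFredholm (T.restrict h.mapsTo_left) ∧
      IsQuasiNilpotent (T.restrict h.mapsTo_right)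

/-- `T` is lower pseudo semi-B-Fredholm. -/
def IsLowerPseudoSemiBFredholm (T : Y →L[ℂ] Y) : Prop :=
  ∃ (M N : Submodule ℂ Y) (h : Reduces T M N),
    IsLowerSemiFredholm (T.restrict h.mapsTo_left) ∧
      IsQuasiNilpotent (T.restrict h.mapsTo_right)

/-- `T` is pseudo semi-B-Fredholm. -/
def IsPseudoSemiBFredholm (T : Y →L[ℂ] Y) : Prop :=
  IsUpperPseudoSemiBFredholm T ∨ IsLowerPseudoSemiBFredholm T

/-- `T` is pseudo-Fredholm: it has a generalized Kato decomposition. -/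
def IsPseudoFredholm (T : Y →L[ℂ] Y) : Prop :=
  ∃ (M N : Submodule ℂ Y) (h : Reduces T M N),
    IsSemiRegular (T.restrict h.mapsTo_left) ∧
      IsQuasiNilpotent (T.restrict h.mapsTo_right)

end Operators

end PseudoFredholm

namespace PseudoFredholm

open Submodule

/-! ### Closed ranges of powers of semi-Fredholm operators -/

section ClosedRange

variable {Y : Type*} [NormedAddCommGroup Y] [NormedSpace ℂ Y]

/-! Failure of semi-regularity on `M` is caused by finite Jordan chains, which can be moved into `N`
one at a time. If `T_M` is semi-Fredholm, its powers have closed range. If its kernel is not in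
every `R(T_M ^ n)`, some `y ∈ M` has `T ^ (n + 1) y = 0` and `T ^ n y ∉ T ^ (n + 1) M`
(`exists_jordanChain_of_not_ker_le`). Hahn-Banach gives `f` vanishing on `T ^ (n + 1) M` with `f (T
^ n y) ≠ 0`. The vectors of `M` killed by every `f ∘ T ^ i` then form a closed invariant complement
`M'` in `M` of the span `L` of the chain (`Reduces.exists_splitting`). As `T` is nilpotent on `L`,
it stays quasi-nilpotent on `L ⊔ N`.

Passing from `M` to `M'` strictly lowers the nullity (upper case) or the defect (lower case), so
strong induction on that number ends at a semi-regular restriction. -/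

theorem exists_continuousLinearMap_eq_zero_on {p : Submodule ℂ Y} (hp : IsClosed (p : Set Y))
    {x : Y} (hx : x ∉ p) : ∃ f : Y →L[ℂ] ℂ, f x ≠ 0 ∧ ∀ z ∈ p, f z = 0 := by
  have := hp
  have hx' : p.mkQ x ≠ 0 := by simpa using hx
  obtain ⟨g, hg⟩ := SeparatingDual.exists_ne_zero (R := ℂ) hx'
  refine ⟨g.comp p.mkQL, hg, fun z hz => ?_⟩
  have : p.mkQ z = 0 := by simpa using hz
  change g (p.mkQ z) = 0
  rw [this, map_zero]

theorem finrank_quotient_lt_of_lt {s t : Submodule ℂ Y} [FiniteDimensional ℂ (Y ⧸ s)]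
    (h : s < t) :
    FiniteDimensional ℂ (Y ⧸ t) ∧ Module.finrank ℂ (Y ⧸ t) < Module.finrank ℂ (Y ⧸ s) := by
  have hsurj : Function.Surjective (Submodule.factor h.le) := Submodule.factor_surjective h.le
  have hfin : FiniteDimensional ℂ (Y ⧸ t) := Module.Finite.of_surjective _ hsurj
  refine ⟨hfin, (LinearMap.finrank_le_finrank_of_surjective hsurj).lt_of_ne fun heq => ?_⟩
  have hinj := (LinearMap.injective_iff_surjective_of_finrank_eq_finrank heq.symm).2 hsurj
  refine h.not_ge fun z hz => ?_
  rw [← Submodule.Quotient.mk_eq_zero]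
  apply hinj
  simpa using hz

theorem range_pow_succ (T : Y →L[ℂ] Y) (n : ℕ) :
    (T ^ (n + 1)).range = (T ^ n).range.map T.toLinearMap := by
  ext z
  rw [pow_succ']
  constructor
  · rintro ⟨y, rfl⟩
    exact ⟨(T ^ n) y, ⟨y, rfl⟩, rfl⟩
  · rintro ⟨_, ⟨y, rfl⟩, rfl⟩
    exact ⟨y, rfl⟩

/-- If `C` and `D` are finite-dimensional complements of `R(T ^ n)` and `R(T)`, then `T C + D`
supplements `R(T ^ (n + 1)) = T (R(T ^ n))`. -/
theorem IsLowerSemiFredholm.pow {T : Y →L[ℂ] Y} (hT : IsLowerSemiFredholm T) (n : ℕ) :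
    IsLowerSemiFredholm (T ^ n) := by
  have : FiniteDimensional ℂ (Y ⧸ T.range) := hT
  induction n with
  | zero =>
    have : (T ^ 0).range = ⊤ := by
      rw [pow_zero]; exact LinearMap.range_id
    unfold IsLowerSemiFredholm
    rw [this]
    infer_instance
  | succ n ih =>
    obtain ⟨C, hC⟩ := Submodule.exists_isCompl (T ^ n).range
    obtain ⟨D, hD⟩ := Submodule.exists_isCompl T.range
    have : FiniteDimensional ℂ (Y ⧸ (T ^ n).range) := ih
    have : FiniteDimensional ℂ C :=
      Module.Finite.equiv (Submodule.quotientEquivOfIsCompl _ _ hC)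
    have : FiniteDimensional ℂ D :=
      Module.Finite.equiv (Submodule.quotientEquivOfIsCompl _ _ hD)
    have htop : (T ^ (n + 1)).range ⊔ (C.map T.toLinearMap ⊔ D) = ⊤ := by
      rw [range_pow_succ, ← sup_assoc, ← Submodule.map_sup, hC.sup_eq_top, Submodule.map_top,
        hD.sup_eq_top]
    let E := C.map T.toLinearMap ⊔ D
    refine Module.Finite.of_surjective (((T ^ (n + 1)).range.mkQ).comp E.subtype) ?_
    intro q
    obtain ⟨z, rfl⟩ := Submodule.mkQ_surjective _ q
    have hz : z ∈ (T ^ (n + 1)).range ⊔ E := by rw [htop]; trivial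
    obtain ⟨a, ha, e, he, rfl⟩ := Submodule.mem_sup.1 hz
    refine ⟨⟨e, he⟩, ?_⟩
    have : (T ^ (n + 1)).range.mkQ a = 0 := by simpa using ha
    rw [map_add, this, zero_add]
    rfl

variable [CompleteSpace Y]

/-- By the open mapping theorem `T` is a quotient map onto its closed range, and the preimage of `T
F` is `F + ker T`, closed because `ker T` is finite-dimensional. -/
theorem isClosed_map_of_isUpperSemiFredholm {T : Y →L[ℂ] Y} (hT : IsUpperSemiFredholm T)
    {F : Submodule ℂ Y} (hF : IsClosed (F : Set Y)) :
    IsClosed (F.map T.toLinearMap : Set Y) := by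
  obtain ⟨hcl, hfin⟩ := hT
  have : CompleteSpace T.range := hcl.completeSpace_coe
  have hsurj : Function.Surjective T.rangeRestrict := fun ⟨_, y, hy⟩ => ⟨y, Subtype.ext hy⟩
  have hpre : IsClosed (F.map T.rangeRestrict.toLinearMap : Set T.range) := by
    rw [← (T.rangeRestrict.isQuotientMap hsurj).isClosed_preimage]
    have := F.isClosed_sup_finiteDimensional T.ker hF
    convert this using 1
    ext z
    simp only [Set.mem_preimage, SetLike.mem_coe, Submodule.mem_map, Submodule.mem_sup]
    constructor
    · rintro ⟨y, hy, hyz⟩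
      have hyz' : T y = T z := congrArg Subtype.val hyz
      exact ⟨y, hy, z - y, by simp [LinearMap.mem_ker, hyz'], by abel⟩
    · rintro ⟨y, hy, k, hk, rfl⟩
      refine ⟨y, hy, Subtype.ext ?_⟩
      have hk' : T k = 0 := hk
      change T y = T (y + k)
      rw [map_add, hk', add_zero]
  have := hcl.isClosedEmbedding_subtypeVal.isClosedMap _ hpre
  convert this using 1
  ext z
  simp only [SetLike.mem_coe, Submodule.mem_map, Set.mem_image]
  constructor
  · rintro ⟨y, hy, rfl⟩
    exact ⟨T.rangeRestrict y, ⟨y, hy, rfl⟩, rfl⟩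
  · rintro ⟨_, ⟨y, hy, rfl⟩, rfl⟩
    exact ⟨y, hy, rfl⟩

/-- With `C` a finite-dimensional algebraic complement of the range, `(y, c) ↦ T y + c` is an open
surjection under which the range pulls back to the closed set `c = 0`. -/
theorem isClosed_range_of_isLowerSemiFredholm {T : Y →L[ℂ] Y} (hT : IsLowerSemiFredholm T) :
    IsClosed (T.range : Set Y) := by
  obtain ⟨C, hC⟩ := Submodule.exists_isCompl T.range
  have : FiniteDimensional ℂ (Y ⧸ T.range) := hT
  have : FiniteDimensional ℂ C :=
    Module.Finite.equiv (Submodule.quotientEquivOfIsCompl _ _ hC)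
  have : CompleteSpace C := FiniteDimensional.complete ℂ C
  let S : (Y × C) →L[ℂ] Y := T.coprod C.subtypeL
  have hsurj : Function.Surjective S := fun z => by
    have hz : z ∈ T.range ⊔ C := by rw [hC.sup_eq_top]; trivial
    obtain ⟨_, ⟨y, rfl⟩, c, hc, rfl⟩ := Submodule.mem_sup.1 hz
    exact ⟨(y, ⟨c, hc⟩), rfl⟩
  rw [← (S.isQuotientMap hsurj).isClosed_preimage]
  have heq : S ⁻¹' T.range = {w : Y × C | w.2 = 0} := by
    refine Set.ext fun ⟨y, c⟩ => ?_
    change S (y, c) ∈ T.range ↔ c = 0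
    have hS : S (y, c) = T y + c := rfl
    have hTy : T y ∈ T.range := ⟨y, rfl⟩
    rw [hS, Submodule.add_mem_iff_right _ hTy]
    constructor
    · intro h
      exact Subtype.ext (Submodule.disjoint_def.1 hC.disjoint _ h c.2)
    · rintro rfl
      exact zero_mem _
  rw [heq]
  exact isClosed_eq continuous_snd continuous_const

theorem IsSemiFredholm.isClosed_range_pow {T : Y →L[ℂ] Y} (hT : IsSemiFredholm T) (n : ℕ) :
    IsClosed ((T ^ n).range : Set Y) := by
  rcases hT with hT | hT
  · induction n with
    | zero =>
      have : (T ^ 0).range = ⊤ := by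
        rw [pow_zero]; exact LinearMap.range_id
      rw [this]
      exact isClosed_univ
    | succ n ih =>
      rw [range_pow_succ]
      exact isClosed_map_of_isUpperSemiFredholm hT ih
  · exact isClosed_range_of_isLowerSemiFredholm (hT.pow n)

end ClosedRange

end PseudoFredholm

namespace PseudoFredholm

open Submodule

variable {X : Type*} [NormedAddCommGroup X] [NormedSpace ℂ X]

/-! ### Jordan chains and their invariant complements -/

section JordanChain

theorem mapsTo_pow {T : X →L[ℂ] X} {M : Submodule ℂ X} (hM : Set.MapsTo T M M) (n : ℕ) :
    Set.MapsTo (T ^ n : X →L[ℂ] X) M M := by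
  induction n with
  | zero => exact fun _ hz => hz
  | succ n ih =>
    rw [pow_succ']
    exact fun _ hz => hM (ih hz)

theorem restrict_pow_apply {T : X →L[ℂ] X} {M : Submodule ℂ X} (hM : Set.MapsTo T M M) (n : ℕ)
    (y : M) : (((T.restrict hM) ^ n) y : X) = (T ^ n) y := by
  induction n with
  | zero => rfl
  | succ n ih =>
    rw [pow_succ', pow_succ']
    change T (((T.restrict hM) ^ n) y : X) = T ((T ^ n) y)
    rw [ih]

theorem pow_add_apply (T : X →L[ℂ] X) (i j : ℕ) (z : X) :
    (T ^ i) ((T ^ j) z) = (T ^ (i + j)) z := by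
  rw [pow_add]; rfl

theorem pow_apply_eq_zero_of_le {T : X →L[ℂ] X} {y : X} {m n : ℕ} (hy : (T ^ m) y = 0)
    (h : m ≤ n) : (T ^ n) y = 0 := by
  obtain ⟨k, rfl⟩ := Nat.exists_eq_add_of_le' h
  rw [← pow_add_apply, hy, map_zero]

/-- The span of the vectors `T ^ j y` with `k ≤ j`. -/
def orbitSpan (T : X →L[ℂ] X) (y : X) (k : ℕ) : Submodule ℂ X :=
  span ℂ {z | ∃ j, k ≤ j ∧ (T ^ j) y = z}

variable {T : X →L[ℂ] X} {y : X}

theorem pow_mem_orbitSpan {j k : ℕ} (h : k ≤ j) : (T ^ j) y ∈ orbitSpan T y k :=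
  subset_span ⟨j, h, rfl⟩

theorem orbitSpan_le {k : ℕ} {p : Submodule ℂ X} (h : ∀ j, k ≤ j → (T ^ j) y ∈ p) :
    orbitSpan T y k ≤ p :=
  span_le.2 fun _ ⟨j, hj, hz⟩ => hz ▸ h j hj

theorem orbitSpan_eq_sup (k : ℕ) :
    orbitSpan T y k = span ℂ {(T ^ k) y} ⊔ orbitSpan T y (k + 1) := by
  apply le_antisymm
  · refine orbitSpan_le fun j hj => ?_
    rcases hj.eq_or_lt with rfl | hj
    · exact mem_sup_left (mem_span_singleton_self _)
    · exact mem_sup_right (pow_mem_orbitSpan hj)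
  · refine sup_le ?_ (orbitSpan_le fun j hj => pow_mem_orbitSpan (by lia))
    rw [span_singleton_le_iff_mem]
    exact pow_mem_orbitSpan le_rfl

theorem orbitSpan_eq_bot {m : ℕ} (hy : (T ^ m) y = 0) : orbitSpan T y m = ⊥ :=
  le_bot_iff.1 <| orbitSpan_le fun _ hj => (mem_bot ℂ).2 (pow_apply_eq_zero_of_le hy hj)

theorem finiteDimensional_orbitSpan {m : ℕ} (hy : (T ^ m) y = 0) :
    FiniteDimensional ℂ (orbitSpan T y 0) := by
  have key : ∀ k ≤ m, FiniteDimensional ℂ (orbitSpan T y (m - k)) := by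
    intro k
    induction k with
    | zero =>
      intro _
      rw [Nat.sub_zero, orbitSpan_eq_bot hy]
      infer_instance
    | succ k ih =>
      intro hk
      have := ih (by lia)
      rw [orbitSpan_eq_sup, show m - (k + 1) + 1 = m - k by lia]
      infer_instance
  exact Nat.sub_self m ▸ key m le_rfl

theorem mapsTo_orbitSpan : Set.MapsTo T (orbitSpan T y 0) (orbitSpan T y 0) := by
  have : orbitSpan T y 0 ≤ (orbitSpan T y 0).comap T.toLinearMap :=
    orbitSpan_le fun j _ => by
      change T ((T ^ j) y) ∈ orbitSpan T y 0
      have : T ((T ^ j) y) = (T ^ (j + 1)) y := by rw [pow_succ']; rfl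
      rw [this]
      exact pow_mem_orbitSpan (Nat.zero_le _)
  exact this

theorem pow_apply_eq_zero_of_mem_orbitSpan {i k m : ℕ} (hy : (T ^ m) y = 0) (h : m ≤ i + k)
    {w : X} (hw : w ∈ orbitSpan T y k) : (T ^ i) w = 0 := by
  have : orbitSpan T y k ≤ (T ^ i).ker := orbitSpan_le fun j hj => by
    change (T ^ i) ((T ^ j) y) = 0
    rw [pow_add_apply]
    exact pow_apply_eq_zero_of_le hy (by lia)
  exact this hw

/-- The largest subspace of `M` on which the functionals `f ∘ T ^ i` vanish. -/
noncomputable def annihilated (T : X →L[ℂ] X) (f : X →L[ℂ] ℂ) (M : Submodule ℂ X) : Submodule ℂ X :=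
  M ⊓ ⨅ i : ℕ, (f.comp (T ^ i)).ker

variable {f : X →L[ℂ] ℂ} {M : Submodule ℂ X} {n : ℕ}

theorem mem_annihilated {z : X} :
    z ∈ annihilated T f M ↔ z ∈ M ∧ ∀ i, f ((T ^ i) z) = 0 := by
  rw [annihilated, mem_inf, mem_iInf]
  rfl

theorem isClosed_annihilated (hM : IsClosed (M : Set X)) :
    IsClosed (annihilated T f M : Set X) := by
  rw [annihilated, coe_inf, coe_iInf]
  exact hM.inter (isClosed_iInter fun i => (f.comp (T ^ i)).isClosed_ker)

theorem mapsTo_annihilated (hM : Set.MapsTo T M M) :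
    Set.MapsTo T (annihilated T f M) (annihilated T f M) := by
  intro z hz
  rw [SetLike.mem_coe, mem_annihilated] at hz ⊢
  refine ⟨hM hz.1, fun i => ?_⟩
  have := hz.2 (i + 1)
  rwa [pow_succ] at this

/-- The matrix `f (T ^ (i + j) y)`, `0 ≤ i, j ≤ n`, is anti-triangular with nonzero antidiagonal, so
the coefficients of `w` vanish one by one. -/
theorem disjoint_annihilated_orbitSpan (hy : (T ^ (n + 1)) y = 0) (hf : f ((T ^ n) y) ≠ 0) :
    Disjoint (annihilated T f M) (orbitSpan T y 0) := by
  rw [disjoint_def]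
  intro w hw hw0
  have hw' := (mem_annihilated.1 hw).2
  have key : ∀ k ≤ n + 1, w ∈ orbitSpan T y k := by
    intro k
    induction k with
    | zero => exact fun _ => hw0
    | succ k ih =>
      intro hk
      have h := ih (by lia)
      rw [orbitSpan_eq_sup] at h
      obtain ⟨_, ha, b, hb, hab⟩ := mem_sup.1 h
      obtain ⟨c, rfl⟩ := mem_span_singleton.1 ha
      -- `T ^ (n - k)` kills the later terms and leaves only `c • T ^ n y`.
      have h1 := hw' (n - k)
      rw [← hab, map_add, pow_apply_eq_zero_of_mem_orbitSpan hy (by lia) hb, add_zero, map_smul,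
        map_smul, pow_add_apply, Nat.sub_add_cancel (by lia), smul_eq_mul] at h1
      have hc : c = 0 := (mul_eq_zero.1 h1).resolve_right hf
      rw [← hab, hc, zero_smul, zero_add]
      exact hb
  have := key (n + 1) le_rfl
  rwa [orbitSpan_eq_bot hy, mem_bot] at this

/-- The same anti-triangular system is solved downwards in `i`; the conditions with `i > n` hold on
all of `M` by `hf0`. -/
theorem annihilated_sup_orbitSpan (hM : Set.MapsTo T M M) (hyM : y ∈ M)
    (hy : (T ^ (n + 1)) y = 0) (hf : f ((T ^ n) y) ≠ 0)
    (hf0 : ∀ z ∈ M, f ((T ^ (n + 1)) z) = 0) :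
    annihilated T f M ⊔ orbitSpan T y 0 = M := by
  have hle : orbitSpan T y 0 ≤ M := orbitSpan_le fun j _ => mapsTo_pow hM j hyM
  refine le_antisymm (sup_le inf_le_left hle) fun z hz => ?_
  have key : ∀ k ≤ n + 1, ∃ w ∈ orbitSpan T y 0,
      ∀ i, n + 1 ≤ i + k → f ((T ^ i) (z - w)) = 0 := by
    intro k
    induction k with
    | zero =>
      refine fun _ => ⟨0, zero_mem _, fun i hi => ?_⟩
      obtain ⟨j, rfl⟩ := Nat.exists_eq_add_of_le (show n + 1 ≤ i by lia)
      rw [sub_zero, ← pow_add_apply]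
      exact hf0 _ (mapsTo_pow hM j hz)
    | succ k ih =>
      intro hk
      obtain ⟨w, hw, h⟩ := ih (by lia)
      -- Chosen to meet the condition at `i = n - k`; larger `i` are undisturbed because `T ^ (i +
      -- k) y = 0`.
      let c := f ((T ^ (n - k)) (z - w)) / f ((T ^ n) y)
      refine ⟨w + c • (T ^ k) y,
        add_mem hw (smul_mem _ _ (pow_mem_orbitSpan (Nat.zero_le _))), fun i hi => ?_⟩
      rw [← sub_sub, map_sub, map_sub, map_smul, map_smul, pow_add_apply, smul_eq_mul]
      rcases (show n - k ≤ i by lia).eq_or_lt with rfl | hlt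
      · rw [Nat.sub_add_cancel (by lia), div_mul_cancel₀ _ hf, sub_self]
      · rw [h i (by lia), pow_apply_eq_zero_of_le hy (by lia), map_zero, mul_zero, sub_zero]
  obtain ⟨w, hw, h⟩ := key (n + 1) le_rfl
  rw [← sub_add_cancel z w]
  exact add_mem (mem_sup_left (mem_annihilated.2 ⟨sub_mem hz (hle hw), fun i => h i (by lia)⟩))
    (mem_sup_right hw)

end JordanChain

/-! ### Quasi-nilpotent restrictions -/

section QuasiNilpotent

/-- By the bounded inverse theorem, invertibility of `c - T` on `N` is mere bijectivity, which is
checked on vectors of `X`. -/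
theorem isQuasiNilpotent_restrict_iff [CompleteSpace X] {T : X →L[ℂ] X} {N : Submodule ℂ X}
    (hcl : IsClosed (N : Set X)) (hN : Set.MapsTo T N N) :
    IsQuasiNilpotent (T.restrict hN) ↔
      ∀ c : ℂ, c ≠ 0 → (∀ u ∈ N, c • u - T u = 0 → u = 0) ∧
        ∀ v ∈ N, ∃ u ∈ N, c • u - T u = v := by
  have : CompleteSpace N := hcl.completeSpace_coe
  have hcoe : ∀ (c : ℂ) (u : N),
      ((algebraMap ℂ (N →L[ℂ] N) c - T.restrict hN) u : X) = c • (u : X) - T u := fun c u => by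
    rw [Algebra.algebraMap_eq_smul_one]; rfl
  have hiff : ∀ c : ℂ, c ∉ spectrum ℂ (T.restrict hN) ↔
      (∀ u ∈ N, c • u - T u = 0 → u = 0) ∧ ∀ v ∈ N, ∃ u ∈ N, c • u - T u = v := by
    intro c
    rw [spectrum.notMem_iff, ContinuousLinearMap.isUnit_iff_bijective, Function.Bijective,
      injective_iff_map_eq_zero]
    refine and_congr ⟨fun h u hu h0 => ?_, fun h u h0 => ?_⟩
      ⟨fun h v hv => ?_, fun h v => ?_⟩
    · exact congrArg Subtype.val (h ⟨u, hu⟩ (Subtype.ext ((hcoe c ⟨u, hu⟩).trans h0)))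
    · exact Subtype.ext (h u u.2 ((hcoe c u).symm.trans (congrArg Subtype.val h0)))
    · obtain ⟨u, hu⟩ := h ⟨v, hv⟩
      exact ⟨u, u.2, (hcoe c u).symm.trans (congrArg Subtype.val hu)⟩
    · obtain ⟨u, hu, huv⟩ := h v v.2
      exact ⟨⟨u, hu⟩, Subtype.ext ((hcoe c ⟨u, hu⟩).trans huv)⟩
  simp only [← hiff]
  exact ⟨fun h c hc hmem => hc (h hmem), fun h c hmem => by_contra fun hc => h c hc hmem⟩

theorem isQuasiNilpotent_restrict_sup [CompleteSpace X] {T : X →L[ℂ] X} {A B : Submodule ℂ X}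
    (hAcl : IsClosed (A : Set X)) (hBcl : IsClosed (B : Set X))
    (hABcl : IsClosed ((A ⊔ B : Submodule ℂ X) : Set X))
    (hA : Set.MapsTo T A A) (hB : Set.MapsTo T B B)
    (hAB : Set.MapsTo T (A ⊔ B : Submodule ℂ X) (A ⊔ B : Submodule ℂ X))
    (hdisj : Disjoint A B)
    (hqA : IsQuasiNilpotent (T.restrict hA)) (hqB : IsQuasiNilpotent (T.restrict hB)) :
    IsQuasiNilpotent (T.restrict hAB) := by
  rw [isQuasiNilpotent_restrict_iff ‹_›] at hqA hqB ⊢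
  intro c hc
  obtain ⟨injA, surjA⟩ := hqA c hc
  obtain ⟨injB, surjB⟩ := hqB c hc
  constructor
  · intro u hu h
    obtain ⟨a, ha, b, hb, rfl⟩ := mem_sup.1 hu
    have hsum : (c • a - T a) = -(c • b - T b) := by
      rw [eq_neg_iff_add_eq_zero, ← h, smul_add, map_add]; abel
    have hA' : c • a - T a ∈ A := sub_mem (smul_mem _ _ ha) (hA ha)
    have h0 : c • a - T a = 0 := disjoint_def.1 hdisj _ hA'
      (hsum ▸ neg_mem (sub_mem (smul_mem _ _ hb) (hB hb)))
    rw [injA a ha h0, injB b hb (neg_eq_zero.1 (hsum.symm.trans h0)), add_zero]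
  · intro v hv
    obtain ⟨a, ha, b, hb, rfl⟩ := mem_sup.1 hv
    obtain ⟨a', ha', rfl⟩ := surjA a ha
    obtain ⟨b', hb', rfl⟩ := surjB b hb
    exact ⟨a' + b', add_mem (mem_sup_left ha') (mem_sup_right hb'), by
      rw [smul_add, map_add]; abel⟩

theorem isQuasiNilpotent_of_pow_eq_zero {T : X →L[ℂ] X} {m : ℕ} (h : T ^ m = 0) :
    IsQuasiNilpotent T := by
  intro c hc
  by_contra hc0
  have hu : IsUnit (algebraMap ℂ (X →L[ℂ] X) c) := (IsUnit.mk0 c hc0).map _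
  have hnil : IsNilpotent (-T) := IsNilpotent.neg ⟨m, h⟩
  refine hc ?_
  rw [spectrum.mem_resolventSet_iff, sub_eq_add_neg]
  exact hnil.isUnit_add_left_of_commute hu (Algebra.commutes c (-T)).symm

end QuasiNilpotent

end PseudoFredholm

namespace PseudoFredholm

open Submodule

variable {X : Type*} [NormedAddCommGroup X] [NormedSpace ℂ X] {T : X →L[ℂ] X}
  {M N : Submodule ℂ X}

/-! ### Restrictions described inside the ambient space -/

section Restrict

theorem map_subtype_range_restrict_pow (hM : Set.MapsTo T M M) (n : ℕ) :
    (((T.restrict hM) ^ n).range).map M.subtype = M.map (T ^ n).toLinearMap := by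
  ext z
  constructor
  · rintro ⟨_, ⟨y, rfl⟩, rfl⟩
    exact ⟨y, y.2, (restrict_pow_apply hM n y).symm⟩
  · rintro ⟨y, hy, rfl⟩
    exact ⟨_, ⟨⟨y, hy⟩, rfl⟩, restrict_pow_apply hM n ⟨y, hy⟩⟩

theorem isClosed_map_pow_iff (hcl : IsClosed (M : Set X)) (hM : Set.MapsTo T M M) (n : ℕ) :
    IsClosed (M.map (T ^ n).toLinearMap : Set X) ↔
      IsClosed (((T.restrict hM) ^ n).range : Set M) := by
  rw [← map_subtype_range_restrict_pow hM, hcl.isClosedEmbedding_subtypeVal.isClosed_iff_image_isClosed]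
  rfl

theorem isClosed_range_restrict_iff (hcl : IsClosed (M : Set X)) (hM : Set.MapsTo T M M) :
    IsClosed ((T.restrict hM).range : Set M) ↔ IsClosed (M.map T.toLinearMap : Set X) := by
  have := isClosed_map_pow_iff hcl hM 1
  rw [pow_one, pow_one] at this
  exact this.symm

theorem map_subtype_ker_restrict (hM : Set.MapsTo T M M) :
    ((T.restrict hM).ker).map M.subtype = M ⊓ T.ker := by
  ext z
  constructor
  · rintro ⟨y, hy, rfl⟩
    exact ⟨y.2, congrArg Subtype.val (show T.restrict hM y = 0 from hy)⟩
  · rintro ⟨hz, hz0⟩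
    exact ⟨⟨z, hz⟩, Subtype.ext hz0, rfl⟩

/-- The kernel of the restriction to `M` is the part of the kernel lying in `M`. -/
noncomputable def kerRestrictEquiv (hM : Set.MapsTo T M M) :
    (T.restrict hM).ker ≃ₗ[ℂ] (M ⊓ T.ker : Submodule ℂ X) :=
  (Submodule.equivMapOfInjective M.subtype M.injective_subtype _).trans
    (LinearEquiv.ofEq _ _ (map_subtype_ker_restrict hM))

theorem isUpperSemiFredholm_restrict_iff (hcl : IsClosed (M : Set X)) (hM : Set.MapsTo T M M) :
    IsUpperSemiFredholm (T.restrict hM) ↔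
      IsClosed (M.map T.toLinearMap : Set X) ∧
        FiniteDimensional ℂ (M ⊓ T.ker : Submodule ℂ X) :=
  and_congr (isClosed_range_restrict_iff hcl hM)
    ⟨fun _ => Module.Finite.equiv (kerRestrictEquiv hM),
      fun _ => Module.Finite.equiv (kerRestrictEquiv hM).symm⟩

/-- The cokernel of the restriction to `M`, computed in the ambient space. -/
noncomputable def quotientRangeRestrictEquiv (hM : Set.MapsTo T M M) (hMN : IsCompl M N) :
    (M ⧸ (T.restrict hM).range) ≃ₗ[ℂ] (X ⧸ (M.map T.toLinearMap ⊔ N)) := by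
  refine (Submodule.quotEquivOfEq _ _ ?_).trans
    (((M.map T.toLinearMap ⊔ N).mkQ.comp M.subtype).quotKerEquivOfSurjective ?_)
  · ext ⟨z, hz⟩
    rw [LinearMap.mem_ker, LinearMap.comp_apply, mkQ_apply, Quotient.mk_eq_zero]
    constructor
    · rintro ⟨y, hy⟩
      exact mem_sup_left ⟨y, y.2, congrArg Subtype.val hy⟩
    · intro h
      obtain ⟨_, ⟨m, hm, rfl⟩, v, hv, hmv⟩ := mem_sup.1 h
      have hvM : v ∈ M := by
        rw [eq_sub_of_add_eq' hmv]
        exact sub_mem hz (hM hm)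
      rw [disjoint_def.1 hMN.disjoint v hvM hv, add_zero] at hmv
      exact ⟨⟨m, hm⟩, Subtype.ext hmv⟩
  · intro q
    obtain ⟨z, rfl⟩ := mkQ_surjective _ q
    obtain ⟨m, hm, v, hv, rfl⟩ := mem_sup.1 (show z ∈ M ⊔ N by rw [hMN.sup_eq_top]; trivial)
    refine ⟨⟨m, hm⟩, ?_⟩
    have : (M.map T.toLinearMap ⊔ N).mkQ v = 0 := by
      rw [mkQ_apply, Quotient.mk_eq_zero]
      exact mem_sup_right hv
    rw [map_add, this, add_zero]
    rfl

theorem isLowerSemiFredholm_restrict_iff (hM : Set.MapsTo T M M) (hMN : IsCompl M N) :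
    IsLowerSemiFredholm (T.restrict hM) ↔
      FiniteDimensional ℂ (X ⧸ (M.map T.toLinearMap ⊔ N)) :=
  ⟨fun h => have : FiniteDimensional ℂ (M ⧸ (T.restrict hM).range) := h
    Module.Finite.equiv (quotientRangeRestrictEquiv hM hMN),
    fun _ => Module.Finite.equiv (quotientRangeRestrictEquiv hM hMN).symm⟩

/-- Take `x` in the kernel and the least power whose range misses it; `y` is a preimage of `x` under
the preceding power. -/
theorem exists_jordanChain_of_not_ker_le (hM : Set.MapsTo T M M)
    (h : ¬ (T.restrict hM).ker ≤ ⨅ n : ℕ, ((T.restrict hM) ^ n).range) :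
    ∃ n : ℕ, ∃ y ∈ M, (T ^ (n + 1)) y = 0 ∧
      (T ^ n) y ∉ M.map (T ^ (n + 1)).toLinearMap := by
  classical
  obtain ⟨x, hx, hx'⟩ := SetLike.not_le_iff_exists.1 h
  rw [mem_iInf, not_forall] at hx'
  set n := Nat.find hx' with hn
  have hspec : x ∉ ((T.restrict hM) ^ n).range := Nat.find_spec hx'
  obtain ⟨m, hm⟩ : ∃ m, n = m + 1 := Nat.exists_eq_succ_of_ne_zero fun h0 => hspec <| by
    rw [h0]; exact ⟨x, rfl⟩
  obtain ⟨y, hy⟩ : x ∈ ((T.restrict hM) ^ m).range := not_not.1 (Nat.find_min hx' (by lia))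
  have hxy : (T ^ m) (y : X) = x := by
    rw [← restrict_pow_apply hM]
    exact congrArg Subtype.val hy
  refine ⟨m, y, y.2, ?_, fun hmem => hspec ?_⟩
  · rw [pow_succ']
    change T ((T ^ m) (y : X)) = 0
    rw [hxy]
    exact congrArg Subtype.val (show T.restrict hM x = 0 from hx)
  · rw [hxy, ← map_subtype_range_restrict_pow hM, ← hm] at hmem
    obtain ⟨x', hx', hxx'⟩ := hmem
    rwa [← M.injective_subtype hxx']

end Restrict

/-! ### Splitting off chains and the two inductions -/

section Split

variable [CompleteSpace X]

/-- Splitting off a Jordan chain of `M` which is not contained in a longer one. -/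
theorem Reduces.exists_splitting (h : Reduces T M N)
    (hq : IsQuasiNilpotent (T.restrict h.mapsTo_right)) {n : ℕ} {y : X} (hyM : y ∈ M)
    (hy : (T ^ (n + 1)) y = 0) (hyn : (T ^ n) y ∉ M.map (T ^ (n + 1)).toLinearMap)
    (hcl : IsClosed (M.map (T ^ (n + 1)).toLinearMap : Set X)) :
    ∃ (M' L : Submodule ℂ X) (h' : Reduces T M' (L ⊔ N)),
      IsQuasiNilpotent (T.restrict h'.mapsTo_right) ∧ M' ⊔ L = M ∧ Disjoint M' L ∧
        Set.MapsTo T L L ∧ y ∈ L ∧ (T ^ n) y ∉ M' := by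
  obtain ⟨f, hf, hf0⟩ := exists_continuousLinearMap_eq_zero_on hcl hyn
  set M' := annihilated T f M
  set L := orbitSpan T y 0
  have hLfin : FiniteDimensional ℂ L := finiteDimensional_orbitSpan hy
  have hLcl : IsClosed (L : Set X) := L.closed_of_finiteDimensional
  have hML : M' ⊔ L = M := annihilated_sup_orbitSpan h.mapsTo_left hyM hy hf
    fun z hz => hf0 _ ⟨z, hz, rfl⟩
  have hdisj : Disjoint M' L := disjoint_annihilated_orbitSpan hy hf
  have hLM : L ≤ M := hML ▸ le_sup_right
  have hM'M : M' ≤ M := hML ▸ le_sup_left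
  have hLmaps : Set.MapsTo T L L := mapsTo_orbitSpan
  have hLNcl : IsClosed ((L ⊔ N : Submodule ℂ X) : Set X) := by
    rw [sup_comm]
    exact N.isClosed_sup_finiteDimensional L h.isClosed_right
  have hLN : Set.MapsTo T (L ⊔ N : Submodule ℂ X) (L ⊔ N : Submodule ℂ X) := by
    intro z hz
    obtain ⟨a, ha, b, hb, rfl⟩ := mem_sup.1 hz
    rw [SetLike.mem_coe, map_add]
    exact add_mem (mem_sup_left (hLmaps ha)) (mem_sup_right (h.mapsTo_right hb))
  have hred : Reduces T M' (L ⊔ N) :=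
    { isClosed_left := isClosed_annihilated h.isClosed_left
      isClosed_right := hLNcl
      mapsTo_left := mapsTo_annihilated h.mapsTo_left
      mapsTo_right := hLN
      isCompl := by
        refine ⟨disjoint_def.2 fun z hz hz' => ?_, codisjoint_iff.2 ?_⟩
        · obtain ⟨a, ha, b, hb, rfl⟩ := mem_sup.1 hz'
          have hbM : b ∈ M := by
            rw [← add_sub_cancel_left a b]
            exact sub_mem (hM'M hz) (hLM ha)
          rw [disjoint_def.1 h.isCompl.disjoint b hbM hb, add_zero] at hz ⊢
          exact disjoint_def.1 hdisj a hz ha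
        · rw [← sup_assoc, hML, h.isCompl.sup_eq_top] }
  refine ⟨M', L, hred, ?_, hML, hdisj, hLmaps, pow_mem_orbitSpan (j := 0) le_rfl, fun hmem => ?_⟩
  · refine isQuasiNilpotent_restrict_sup hLcl h.isClosed_right hLNcl hLmaps h.mapsTo_right hLN
      (h.isCompl.disjoint.mono_left hLM) (isQuasiNilpotent_of_pow_eq_zero (m := n + 1) ?_) hq
    ext z
    rw [restrict_pow_apply]
    exact pow_apply_eq_zero_of_mem_orbitSpan hy (by lia) z.2
  · exact hf ((mem_annihilated.1 hmem).2 0)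

theorem Reduces.isClosed_map_pow (h : Reduces T M N)
    (hs : IsSemiFredholm (T.restrict h.mapsTo_left)) (n : ℕ) :
    IsClosed (M.map (T ^ n).toLinearMap : Set X) :=
  have : CompleteSpace M := h.isClosed_left.completeSpace_coe
  (isClosed_map_pow_iff h.isClosed_left h.mapsTo_left n).2 (hs.isClosed_range_pow n)

theorem Reduces.isSemiRegular (h : Reduces T M N)
    (hs : IsSemiFredholm (T.restrict h.mapsTo_left))
    (hk : (T.restrict h.mapsTo_left).ker ≤ ⨅ n : ℕ, ((T.restrict h.mapsTo_left) ^ n).range) :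
    IsSemiRegular (T.restrict h.mapsTo_left) := by
  refine ⟨(isClosed_range_restrict_iff h.isClosed_left h.mapsTo_left).2 ?_, hk⟩
  have := h.isClosed_map_pow hs 1
  rwa [pow_one] at this

theorem Reduces.exists_isUpperSemiFredholm_isSemiRegular (h : Reduces T M N)
    (hu : IsUpperSemiFredholm (T.restrict h.mapsTo_left))
    (hq : IsQuasiNilpotent (T.restrict h.mapsTo_right)) :
    ∃ (M' N' : Submodule ℂ X) (h' : Reduces T M' N'),
      IsUpperSemiFredholm (T.restrict h'.mapsTo_left) ∧
        IsSemiRegular (T.restrict h'.mapsTo_left) ∧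
        IsQuasiNilpotent (T.restrict h'.mapsTo_right) := by
  induction hd : Module.finrank ℂ (M ⊓ T.ker : Submodule ℂ X) using Nat.strong_induction_on
    generalizing M N with
  | _ d ih =>
  by_cases hk : (T.restrict h.mapsTo_left).ker ≤ ⨅ n : ℕ, ((T.restrict h.mapsTo_left) ^ n).range
  · exact ⟨M, N, h, hu, h.isSemiRegular (.inl hu) hk, hq⟩
  obtain ⟨n, y, hyM, hy, hyn⟩ := exists_jordanChain_of_not_ker_le h.mapsTo_left hk
  obtain ⟨M', L, h', hq', hML, hdisj, hL, hyL, hyM'⟩ :=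
    h.exists_splitting hq hyM hy hyn (h.isClosed_map_pow (.inl hu) _)
  obtain ⟨hcl, hfin⟩ := (isUpperSemiFredholm_restrict_iff h.isClosed_left h.mapsTo_left).1 hu
  have hM'M : M' ≤ M := hML ▸ le_sup_left
  -- The end `T ^ n y` of the chain is a kernel vector lost by `M'`.
  have hlt : M' ⊓ T.ker < M ⊓ T.ker := by
    refine lt_of_le_of_ne (inf_le_inf_right _ hM'M) fun heq => hyM' ?_
    have : (T ^ n) y ∈ M ⊓ T.ker := ⟨mapsTo_pow h.mapsTo_left n hyM, by
      rw [pow_succ'] at hy; exact hy⟩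
    exact (heq ▸ this).1
  -- `M = M' ⊕ L` reduces `T`, so closedness of `T M` passes to `T M'`.
  have hmap : M'.map T.toLinearMap = M.map T.toLinearMap ⊓ M' := by
    refine le_antisymm (le_inf (map_mono hM'M) (map_le_iff_le_comap.2 h'.mapsTo_left)) ?_
    rintro _ ⟨⟨m, hm, rfl⟩, hm'⟩
    rw [SetLike.mem_coe, ← hML] at hm
    obtain ⟨a, ha, b, hb, rfl⟩ := mem_sup.1 hm
    refine ⟨a, ha, ?_⟩
    have hTa : T a ∈ M' := h'.mapsTo_left ha
    have hTb : T b ∈ M' := by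
      rw [← add_sub_cancel_left (T a) (T b), ← map_add]
      exact sub_mem hm' hTa
    have h0 : T b = 0 := disjoint_def.1 hdisj _ hTb (hL hb)
    change T a = T (a + b)
    rw [map_add, h0, add_zero]
  refine ih _ (hd ▸ finrank_lt_finrank_of_lt hlt) h'
    ((isUpperSemiFredholm_restrict_iff h'.isClosed_left h'.mapsTo_left).2 ⟨?_, ?_⟩) hq' rfl
  · rw [hmap]
    exact hcl.inter h'.isClosed_left
  · exact Submodule.finiteDimensional_of_le hlt.le

theorem Reduces.exists_isLowerSemiFredholm_isSemiRegular (h : Reduces T M N)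
    (hl : IsLowerSemiFredholm (T.restrict h.mapsTo_left))
    (hq : IsQuasiNilpotent (T.restrict h.mapsTo_right)) :
    ∃ (M' N' : Submodule ℂ X) (h' : Reduces T M' N'),
      IsLowerSemiFredholm (T.restrict h'.mapsTo_left) ∧
        IsSemiRegular (T.restrict h'.mapsTo_left) ∧
        IsQuasiNilpotent (T.restrict h'.mapsTo_right) := by
  induction hd : Module.finrank ℂ (X ⧸ (M.map T.toLinearMap ⊔ N)) using Nat.strong_induction_on
    generalizing M N with
  | _ d ih =>
  by_cases hk : (T.restrict h.mapsTo_left).ker ≤ ⨅ n : ℕ, ((T.restrict h.mapsTo_left) ^ n).range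
  · exact ⟨M, N, h, hl, h.isSemiRegular (.inr hl) hk, hq⟩
  obtain ⟨n, y, hyM, hy, hyn⟩ := exists_jordanChain_of_not_ker_le h.mapsTo_left hk
  obtain ⟨M', L, h', hq', hML, -, hL, hyL, -⟩ :=
    h.exists_splitting hq hyM hy hyn (h.isClosed_map_pow (.inr hl) _)
  have hfin := (isLowerSemiFredholm_restrict_iff h.mapsTo_left h.isCompl).1 hl
  -- The start `y` of the chain is new: `y = T m` with `m ∈ M` would give `T ^ n y = T ^ (n + 1) m`.
  have hlt : M.map T.toLinearMap ⊔ N < M'.map T.toLinearMap ⊔ (L ⊔ N) := by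
    refine lt_of_le_of_ne ?_ fun heq => hyn ?_
    · rw [← hML, Submodule.map_sup, sup_assoc]
      exact sup_le_sup_left (sup_le_sup_right (map_le_iff_le_comap.2 hL) _) _
    · have hmem : y ∈ M.map T.toLinearMap ⊔ N := heq ▸ mem_sup_right (mem_sup_left hyL)
      obtain ⟨_, ⟨m, hm, rfl⟩, v, hv, hmv⟩ := mem_sup.1 hmem
      have hvM : v ∈ M := by
        rw [eq_sub_of_add_eq' hmv]
        exact sub_mem hyM (h.mapsTo_left hm)
      rw [disjoint_def.1 h.isCompl.disjoint v hvM hv, add_zero] at hmv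
      refine ⟨m, hm, ?_⟩
      rw [← hmv, pow_succ]
      rfl
  obtain ⟨hfin', hlt'⟩ := finrank_quotient_lt_of_lt hlt
  exact ih _ (hd ▸ hlt') h'
    ((isLowerSemiFredholm_restrict_iff h'.mapsTo_left h'.isCompl).2 hfin') hq' rfl

end Split

end PseudoFredholm

theorem mainTheorem8 {X : Type*} [NormedAddCommGroup X] [NormedSpace ℂ X] [CompleteSpace X]
    (T : X →L[ℂ] X) :
    (PseudoFredholm.IsPseudoSemiBFredholm T ↔
      ∃ (M N : Submodule ℂ X) (h : PseudoFredholm.Reduces T M N),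
        (PseudoFredholm.IsSemiFredholm (T.restrict h.mapsTo_left) ∧
          PseudoFredholm.IsSemiRegular (T.restrict h.mapsTo_left)) ∧
        PseudoFredholm.IsQuasiNilpotent (T.restrict h.mapsTo_right)) ∧
    (PseudoFredholm.IsPseudoSemiBFredholm T → PseudoFredholm.IsPseudoFredholm T) := by
  have key : PseudoFredholm.IsPseudoSemiBFredholm T →
      ∃ (M N : Submodule ℂ X) (h : PseudoFredholm.Reduces T M N),
        (PseudoFredholm.IsSemiFredholm (T.restrict h.mapsTo_left) ∧
          PseudoFredholm.IsSemiRegular (T.restrict h.mapsTo_left)) ∧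
        PseudoFredholm.IsQuasiNilpotent (T.restrict h.mapsTo_right) := by
    rintro (⟨M, N, h, hs, hq⟩ | ⟨M, N, h, hs, hq⟩)
    · obtain ⟨M', N', h', hs', hr', hq'⟩ := h.exists_isUpperSemiFredholm_isSemiRegular hs hq
      exact ⟨M', N', h', ⟨.inl hs', hr'⟩, hq'⟩
    · obtain ⟨M', N', h', hs', hr', hq'⟩ := h.exists_isLowerSemiFredholm_isSemiRegular hs hq
      exact ⟨M', N', h', ⟨.inr hs', hr'⟩, hq'⟩
  refine ⟨⟨key, ?_⟩, fun hT => ?_⟩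
  · rintro ⟨M, N, h, ⟨hs | hs, -⟩, hq⟩
    · exact .inl ⟨M, N, h, hs, hq⟩
    · exact .inr ⟨M, N, h, hs, hq⟩
  · obtain ⟨M, N, h, ⟨-, hr⟩, hq⟩ := key hT
    exact ⟨M, N, h, hr, hq⟩
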